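/- Let $N$ be the number of players, let $\mathbf G=[g_{ij}]\in\mathbb R^{N\times N}$ satisfy $g_{ii}=0$ for all $i$, let $\boldsymbol\alpha\in\mathbb R^N$, and let $\mathbf B=\mathrm{diag}(b_1,\dots,b_N)$ with $b_i\in\{0,1\}$. Assume that the spectral radius satisfies $\rho(\mathbf G)<1$ and that $(\mathbf G,\mathbf B)$ is controllable, i.e. $\operatorname{rank}[\mathbf B,\mathbf G\mathbf B,\dots,\mathbf G^{N-1}\mathbf B]=N$. Let $\epsilon\in[0,\frac1{N+1}]$, let $\mathbf v_1,\mathbf v_2,\dots$ be independent $\mathcal N(0,\mathbf I)$ random vectors in $\mathbb R^N$ on a probability space $(\Omega,\mathcal F,\mathbb P)$, let $\mathbf x_0,\mathbf u_0\in\mathbb R^N$ be arbitrary prescribed vectors, and put $$\mathbf u_t=\frac{\mathbf v_t}{t^{\epsilon/2}}\quad(t\ge1),\qquad \mathbf x_{t+1}=\boldsymbol\alpha+\mathbf G\mathbf x_t+\mathbf B\mathbf u_t\quad(t\ge0).$$ Set $\mathbf y_t=\mathbf x_t-\mathbf x_{t-1}$, $\boldsymbol\varphi_t=[\mathbf y_t^\top,\mathbf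 u_t^\top,\mathbf u_{t-1}^\top]^\top\in\mathbb R^{3N}$ for $t\ge1$, and $\mathbf S_n=\sum_{t=1}^n\boldsymbol\varphi_t\boldsymbol\varphi_t^\top$. Then there is an event $\Omega_0$ with $\mathbb P(\Omega_0)=1$ such that for every $\omega\in\Omega_0$: 1. there is a finite integer $n(\omega)$ such that for all $n\ge n(\omega)$ the information matrix $\mathbf S_n$ is nonsingular and the first $N\times N$ block of the ordinary least squares estimate $\bigl(\sum_{t=1}^n\mathbf y_{t+1}\boldsymbol\varphi_t^\top\bigr)\mathbf S_n^{-1}\in\mathbb R^{N\times 3N}$ equals $\mathbf G$ exactly; 2. for every $a\in(\frac12,1-\epsilon)$, $\ \liminf_{n\to\infty} n^{-a}\lambda_{\min}(\mathbf S_n)>0$. -/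

import Mathlib

open MeasureTheory ProbabilityTheory

/-- Kalman controllability of the pair `(G, B)`: the block matrix `[B, G B, …, G ^ (N - 1) B]`
has rank `N`. The column `(k, j)` is the `j`-th column of `G ^ k * B`. -/
def IsControllable {N : ℕ} (G B : Matrix (Fin N) (Fin N) ℝ) : Prop :=
  (Matrix.of fun (i : Fin N) (c : Fin N × Fin N) => (G ^ (c.1 : ℕ) * B) i c.2).rank = N

/-- The probing signal: `u 0` is the prescribed initial input `u₀`, and
`u t = v t / t ^ (ε / 2)` for `t ≥ 1`. -/
noncomputable def probe {N : ℕ} (ε : ℝ) (u₀ : Fin N → ℝ) (v : ℕ → Fin N → ℝ) :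
    ℕ → Fin N → ℝ
  | 0 => u₀
  | t + 1 => (((t + 1 : ℕ) : ℝ) ^ (ε / 2))⁻¹ • v (t + 1)

/-- The probed repeated play `x (t + 1) = α + G x t + B u t` started from `x₀`. -/
def trajectory {N : ℕ} (α : Fin N → ℝ) (G B : Matrix (Fin N) (Fin N) ℝ) (x₀ : Fin N → ℝ)
    (u : ℕ → Fin N → ℝ) : ℕ → Fin N → ℝ
  | 0 => x₀
  | t + 1 => α + G.mulVec (trajectory α G B x₀ u t) + B.mulVec (u t)

/-- The increment `y t = x t - x (t - 1)`; used only for `t ≥ 1`. -/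
def increment {N : ℕ} (x : ℕ → Fin N → ℝ) (t : ℕ) : Fin N → ℝ :=
  x t - x (t - 1)

/-- The regressor `φ t = (y t, u t, u (t - 1))`; used only for `t ≥ 1`. -/
def regressor {N : ℕ} (x u : ℕ → Fin N → ℝ) (t : ℕ) : Fin N ⊕ Fin N ⊕ Fin N → ℝ :=
  Sum.elim (increment x t) (Sum.elim (u t) (u (t - 1)))

/-- The information matrix `∑ t = 1, …, n, φ t (φ t)ᵀ`. -/
def informationMatrix {N : ℕ} (x u : ℕ → Fin N → ℝ) (n : ℕ) :
    Matrix (Fin N ⊕ Fin N ⊕ Fin N) (Fin N ⊕ Fin N ⊕ Fin N) ℝ :=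
  ∑ t ∈ Finset.Icc 1 n, Matrix.vecMulVec (regressor x u t) (regressor x u t)

/-- The ordinary least squares estimate of the coefficient matrix `θᵀ` in the regression
`y (t + 1) = θᵀ φ t`, `t = 1, …, n`. It is computed from the observed actions `x` and inputs `u`
alone, and is meaningful when the information matrix is nonsingular. -/
noncomputable def olsEstimate {N : ℕ} (x u : ℕ → Fin N → ℝ) (n : ℕ) :
    Matrix (Fin N) (Fin N ⊕ Fin N ⊕ Fin N) ℝ :=
  (∑ t ∈ Finset.Icc 1 n, Matrix.vecMulVec (increment x (t + 1)) (regressor x u t)) *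
    (informationMatrix x u n)⁻¹

/-- The first block of the least squares estimate, i.e. the estimate of the interaction matrix. -/
noncomputable def olsInteraction {N : ℕ} (x u : ℕ → Fin N → ℝ) (n : ℕ) :
    Matrix (Fin N) (Fin N) ℝ :=
  (olsEstimate x u n).submatrix id Sum.inl

/-!
# Exact recovery of the interaction matrix under decaying probing noise

The increments satisfy the noise-free recursion `y (t + 1) = G y t + B (u t - u (t - 1))`, that is
`y (t + 1) = [G, B, -B] φ t`. Least squares is therefore exact as soon as the information matrix
`S n` is invertible, and everything reduces to a lower bound on `w ⬝ᵥ S n w = ∑ t, (w ⬝ᵥ φ t) ^ 2`.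
Almost surely this form is eventually at least `c * n ^ (1 - ε) * (w ⬝ᵥ w)`.

To remove the state from the regressor, filter `φ` by the coefficients `c k` of the characteristic
polynomial of `G`. By Cayley–Hamilton, `∑ k ≤ N, c k • φ (τ + 1 + k)` does not depend on
`y (τ + 1)`, hence is a fixed linear image of the window `u τ, …, u (τ + N + 1)`
(`sum_charpoly_mul_dotProduct_regressor`). The transpose `windowMap` of this image is injective
(`windowMap_injective`): reading the coefficients in turn kills the components of `w` along `u t`
and `u (t - 1)`, the latter because `1` is not an eigenvalue of `G`, and controllability kills the
component along `y t`. Over the disjoint windows starting at `m (N + 2) + 1`, Cauchy–Schwarz gives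
`∑ m, (windowMap w ⬝ᵥ U m) ^ 2 ≤ C * (w ⬝ᵥ S n w)`, with `U m` the stacked window
(`sum_window_sq_le`).

It remains to see that disjoint windows of the input are exciting. The noise windows are
independent and identically distributed, so by the strong law their empirical second moments tend
to the identity (`ae_tendsto_average_window`). Within a window all factors `t ^ (-ε / 2)` are
asymptotically equal, so the same holds for the input windows after a common rescaling
(`eventually_window_excitation`), and undoing the rescaling costs at most a factor `n ^ ε`.
-/

/-! ### Controllability and the spectral radius -/

/-- Kalman's rank condition as triviality of the left kernel of `[B, G B, …, G ^ (N - 1) B]`. -/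
theorem IsControllable.eq_zero_of_vecMul {N : ℕ} {G B : Matrix (Fin N) (Fin N) ℝ}
    (h : IsControllable G B) {p : Fin N → ℝ}
    (hp : ∀ k < N, Matrix.vecMul p (G ^ k * B) = 0) : p = 0 := by
  unfold IsControllable at h
  set M := (Matrix.of fun (i : Fin N) (c : Fin N × Fin N) => (G ^ (c.1 : ℕ) * B) i c.2) with hM
  have h1 : Matrix.mulVec M.transpose p = 0 := by
    ext c
    have := congrFun (hp c.1 c.1.2) c.2
    simpa [Matrix.mulVec_transpose, Matrix.vecMul, dotProduct, hM] using this
  have h2 : M.transpose.rank = N := by rw [Matrix.rank_transpose, h]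
  have h3 := LinearMap.finrank_range_add_finrank_ker M.transpose.mulVecLin
  have h4 : Module.finrank ℝ (LinearMap.ker M.transpose.mulVecLin) = 0 := by
    unfold Matrix.rank at h2
    rw [h2] at h3
    simpa using h3
  rw [Submodule.finrank_eq_zero, LinearMap.ker_eq_bot'] at h4
  exact h4 p h1

/-- Stability enters only through this fact: `1` is not an eigenvalue of `G`. -/
theorem charpoly_eval_one_ne_zero {N : ℕ} {G : Matrix (Fin N) (Fin N) ℝ}
    (h : spectralRadius ℂ (G.map (algebraMap ℝ ℂ)) < 1) : G.charpoly.eval 1 ≠ 0 := by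
  intro h0
  have h1 : (1 : ℂ) ∈ spectrum ℂ (G.map (algebraMap ℝ ℂ)) := by
    rw [spectrum.mem_iff, Matrix.isUnit_iff_isUnit_det, isUnit_iff_ne_zero, not_not]
    have h2 : (G.map (algebraMap ℝ ℂ)).charpoly.eval 1 = 0 := by
      rw [Matrix.charpoly_map, ← map_one (algebraMap ℝ ℂ), Polynomial.eval_map_algebraMap,
        Polynomial.aeval_algebraMap_apply, Polynomial.coe_aeval_eq_eval, h0, map_zero]
    rw [Matrix.eval_charpoly] at h2
    simpa using h2
  have h3 : (‖(1 : ℂ)‖₊ : ENNReal) ≤ spectralRadius ℂ (G.map (algebraMap ℝ ℂ)) := by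
    unfold spectralRadius
    exact le_iSup₂ (f := fun (k : ℂ) (_ : k ∈ spectrum ℂ (G.map (algebraMap ℝ ℂ))) =>
      (‖k‖₊ : ENNReal)) 1 h1
  simp at h3
  exact absurd h (not_lt.mpr h3)

/-! ### The charpoly-filtered regressor -/

/-- The quotient `∑ k ∈ (j, N], c k • G ^ (k - 1 - j)`, where `c` are the coefficients of the
characteristic polynomial of `G`: it is the factor by which the input increment at time `j` of a
window enters the filtered state. It vanishes for `j ≥ N`. -/
noncomputable def hornerQuotient {N : ℕ} (G : Matrix (Fin N) (Fin N) ℝ) (j : ℕ) :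
    Matrix (Fin N) (Fin N) ℝ :=
  ∑ k ∈ Finset.Ioc j N, G.charpoly.coeff k • G ^ (k - 1 - j)

theorem hornerQuotient_of_le {N : ℕ} (G : Matrix (Fin N) (Fin N) ℝ) {j : ℕ} (hj : N ≤ j) :
    hornerQuotient G j = 0 := by
  simp [hornerQuotient, Finset.Ioc_eq_empty_of_le hj]

theorem charpoly_coeff_card {N : ℕ} (G : Matrix (Fin N) (Fin N) ℝ) : G.charpoly.coeff N = 1 := by
  have h := G.charpoly_monic.coeff_natDegree
  rwa [Matrix.charpoly_natDegree_eq_dim, Fintype.card_fin] at h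

theorem charpoly_coeff_card_succ {N : ℕ} (G : Matrix (Fin N) (Fin N) ℝ) :
    G.charpoly.coeff (N + 1) = 0 := by
  apply Polynomial.coeff_eq_zero_of_natDegree_lt
  rw [Matrix.charpoly_natDegree_eq_dim, Fintype.card_fin]
  exact Nat.lt_succ_self N

/-- The Horner quotients span the same matrices as the powers of `G`, so controllability may be
tested on them. -/
theorem IsControllable.eq_zero_of_hornerQuotient {N : ℕ} {G B : Matrix (Fin N) (Fin N) ℝ}
    (h : IsControllable G B) {p : Fin N → ℝ}
    (hp : ∀ j < N, Matrix.vecMul p (hornerQuotient G j * B) = 0) : p = 0 := by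
  refine h.eq_zero_of_vecMul fun k => ?_
  induction k using Nat.strong_induction_on with
  | _ k ih =>
    intro hk
    have h1 := hp (N - 1 - k) (by omega)
    -- The top term of the quotient is `G ^ k`; the others are lower powers, handled by induction.
    have h2 : Finset.Ioc (N - 1 - k) N = insert N (Finset.Ioo (N - 1 - k) N) := by
      ext i; simp only [Finset.mem_insert, Finset.mem_Ioc, Finset.mem_Ioo]; omega
    rw [hornerQuotient, h2, Finset.sum_insert (by simp), add_mul, Matrix.vecMul_add,
      charpoly_coeff_card, one_smul, show N - 1 - (N - 1 - k) = k by omega, Finset.sum_mul,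
      Matrix.vecMul_sum, Finset.sum_eq_zero, add_zero] at h1
    · exact h1
    · intro i hi
      rw [Finset.mem_Ioo] at hi
      rw [smul_mul_assoc, Matrix.vecMul_smul, ih _ (by omega) (by omega), smul_zero]

/-- The coefficient vector of the `j`-th input of a window `a 0, …, a (N + 1)` in the
charpoly-filtered regressor tested against `w = (p, q, r)`. -/
noncomputable def windowCoeff {N : ℕ} (G B : Matrix (Fin N) (Fin N) ℝ)
    (w : Fin N ⊕ Fin N ⊕ Fin N → ℝ) : ℕ → Fin N → ℝ
  | 0 => G.charpoly.coeff 0 • (w ∘ Sum.inr ∘ Sum.inr) -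
      Matrix.vecMul (w ∘ Sum.inl) (hornerQuotient G 0 * B)
  | i + 1 => Matrix.vecMul (w ∘ Sum.inl) (hornerQuotient G i * B) -
      Matrix.vecMul (w ∘ Sum.inl) (hornerQuotient G (i + 1) * B) +
      G.charpoly.coeff i • (w ∘ Sum.inr ∘ Sum.inl) +
      G.charpoly.coeff (i + 1) • (w ∘ Sum.inr ∘ Sum.inr)

/-- `windowCoeff` as a linear map in `w`. -/
noncomputable def windowMap {N : ℕ} (G B : Matrix (Fin N) (Fin N) ℝ) :
    (Fin N ⊕ Fin N ⊕ Fin N → ℝ) →ₗ[ℝ] (Fin (N + 2) × Fin N → ℝ) where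
  toFun w := fun e => windowCoeff G B w e.1 e.2
  map_add' w w' := by
    ext ⟨⟨j, hj⟩, i⟩
    have e1 : (w + w') ∘ Sum.inl = w ∘ Sum.inl + w' ∘ Sum.inl := rfl
    cases j <;> simp [windowCoeff, e1, Matrix.add_vecMul] <;> ring
  map_smul' c w := by
    ext ⟨⟨j, hj⟩, i⟩
    have e1 : (c • w) ∘ Sum.inl = c • (w ∘ Sum.inl) := rfl
    cases j <;> simp [windowCoeff, e1, Matrix.smul_vecMul] <;> ring

theorem windowMap_injective {N : ℕ} {G B : Matrix (Fin N) (Fin N) ℝ} (h : IsControllable G B)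
    (h1 : G.charpoly.eval 1 ≠ 0) : Function.Injective (windowMap G B) := by
  rw [← LinearMap.ker_eq_bot, LinearMap.ker_eq_bot']
  intro w hw
  have hz : ∀ j < N + 2, windowCoeff G B w j = 0 := fun j hj => by
    ext i
    exact congrFun hw (⟨j, hj⟩, i)
  set p := w ∘ Sum.inl with hp
  set q := w ∘ Sum.inr ∘ Sum.inl with hq
  set r := w ∘ Sum.inr ∘ Sum.inr with hr
  -- The last coefficient of the window is `q` itself.
  have q0 : q = 0 := by
    have := hz (N + 1) (by omega)
    simpa [windowCoeff, hornerQuotient_of_le, charpoly_coeff_card, charpoly_coeff_card_succ, ← hq]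
      using this
  -- The coefficients add up to `χ(1) • (q + r)`, since the terms in `p` telescope.
  have r0 : r = 0 := by
    have hs : ∀ M, ∑ j ∈ Finset.range (M + 1), windowCoeff G B w j =
        (∑ j ∈ Finset.range (M + 1), G.charpoly.coeff j) • r -
          Matrix.vecMul p (hornerQuotient G M * B) := by
      intro M
      induction M with
      | zero => simp [windowCoeff, ← hr, ← hp]
      | succ M ih =>
        rw [Finset.sum_range_succ, ih, Finset.sum_range_succ _ (M + 1)]
        simp only [windowCoeff, ← hr, ← hp, ← hq, q0, add_smul, smul_zero]
        abel
    have h2 := hs N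
    rw [Finset.sum_eq_zero fun j hj => hz j (by have := Finset.mem_range.1 hj; omega),
      hornerQuotient_of_le G le_rfl] at h2
    rw [Polynomial.eval_eq_sum_range, Matrix.charpoly_natDegree_eq_dim, Fintype.card_fin] at h1
    simp only [one_pow, mul_one] at h1
    simp only [zero_mul, Matrix.vecMul_zero, sub_zero] at h2
    exact (smul_eq_zero.1 h2.symm).resolve_left h1
  have p0 : p = 0 := by
    refine h.eq_zero_of_hornerQuotient fun j => ?_
    induction j with
    | zero =>
      intro _
      have := hz 0 (by omega)
      simpa [windowCoeff, ← hr, ← hp, r0] using this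
    | succ j ih =>
      intro hj
      have := hz (j + 1) (by omega)
      simpa [windowCoeff, ← hr, ← hp, ← hq, r0, q0, ih (by omega)] using this
  ext (i | i | i)
  · exact congrFun p0 i
  · exact congrFun q0 i
  · exact congrFun r0 i

/-- An injective linear map between coordinate spaces is bounded below in the Euclidean norm. -/
theorem exists_pos_mul_dotProduct_le {ι κ : Type*} [Fintype ι] [Fintype κ]
    (f : (ι → ℝ) →ₗ[ℝ] (κ → ℝ)) (hf : Function.Injective f) :
    ∃ c : ℝ, 0 < c ∧ ∀ w, c * (w ⬝ᵥ w) ≤ f w ⬝ᵥ f w := by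
  obtain ⟨K, hK, h⟩ := f.exists_antilipschitzWith (LinearMap.ker_eq_bot.2 hf)
  have hK' : (0 : ℝ) < K := hK
  refine ⟨((Fintype.card ι + 1 : ℝ) * K ^ 2)⁻¹, by positivity, fun w => ?_⟩
  have h1 : ‖w‖ ≤ K * ‖f w‖ := by simpa using h.le_mul_dist w 0
  have h2 : w ⬝ᵥ w ≤ (Fintype.card ι + 1) * ‖w‖ ^ 2 := by
    calc w ⬝ᵥ w ≤ ∑ _i : ι, ‖w‖ ^ 2 := by
          refine Finset.sum_le_sum fun i _ => ?_
          rw [← sq, ← sq_abs, ← Real.norm_eq_abs]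
          gcongr
          exact norm_le_pi_norm w i
      _ ≤ _ := by
          simp only [Finset.sum_const, Finset.card_univ, nsmul_eq_mul]
          gcongr
          linarith
  have h3 : ‖f w‖ ^ 2 ≤ f w ⬝ᵥ f w := by
    have h5 : 0 ≤ f w ⬝ᵥ f w := Finset.sum_nonneg fun i _ => mul_self_nonneg _
    have : ‖f w‖ ≤ √(f w ⬝ᵥ f w) := by
      refine (pi_norm_le_iff_of_nonneg (Real.sqrt_nonneg _)).2 fun i => ?_
      apply Real.le_sqrt_of_sq_le
      rw [Real.norm_eq_abs, sq_abs, sq]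
      exact Finset.single_le_sum (f := fun i => f w i * f w i) (fun i _ => mul_self_nonneg _)
        (Finset.mem_univ i)
    calc ‖f w‖ ^ 2 ≤ √(f w ⬝ᵥ f w) ^ 2 := by gcongr
      _ = _ := Real.sq_sqrt h5
  rw [inv_mul_le_iff₀ (by positivity)]
  calc w ⬝ᵥ w ≤ (Fintype.card ι + 1) * ‖w‖ ^ 2 := h2
    _ ≤ (Fintype.card ι + 1) * (K * ‖f w‖) ^ 2 := by gcongr
    _ = (Fintype.card ι + 1) * K ^ 2 * ‖f w‖ ^ 2 := by ring
    _ ≤ _ := by gcongr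

/-! ### Filtering the closed loop -/

theorem increment_succ_eq_pow {N : ℕ} {G B : Matrix (Fin N) (Fin N) ℝ} {y u : ℕ → Fin N → ℝ}
    (hy : ∀ t, 1 ≤ t → y (t + 1) = G.mulVec (y t) + B.mulVec (u t - u (t - 1)))
    (τ k : ℕ) :
    y (τ + 1 + k) = (G ^ k).mulVec (y (τ + 1)) +
      ∑ j ∈ Finset.range k, (G ^ (k - 1 - j) * B).mulVec (u (τ + j + 1) - u (τ + j)) := by
  induction k with
  | zero => simp
  | succ k ih =>
    rw [← add_assoc, hy _ (by omega), ih, Finset.sum_range_succ, Matrix.mulVec_add,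
      Matrix.mulVec_mulVec, ← pow_succ', add_assoc, Matrix.mulVec_sum]
    congr 2
    · refine Finset.sum_congr rfl fun j hj => ?_
      have := Finset.mem_range.1 hj
      rw [Matrix.mulVec_mulVec, ← mul_assoc, ← pow_succ', show k - 1 - j + 1 = k + 1 - 1 - j by omega]
    · rw [show τ + 1 + k = τ + k + 1 by omega]; simp

/-- By Cayley–Hamilton the filter `∑ k, c k • y (τ + 1 + k)` forgets the state `y (τ + 1)`. -/
theorem sum_charpoly_smul_increment {N : ℕ} {G B : Matrix (Fin N) (Fin N) ℝ}
    {y u : ℕ → Fin N → ℝ}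
    (hy : ∀ t, 1 ≤ t → y (t + 1) = G.mulVec (y t) + B.mulVec (u t - u (t - 1)))
    (τ : ℕ) :
    ∑ k ∈ Finset.range (N + 1), G.charpoly.coeff k • y (τ + 1 + k) =
      ∑ j ∈ Finset.range (N + 1),
        (hornerQuotient G j * B).mulVec (u (τ + j + 1) - u (τ + j)) := by
  have hCH : ∑ k ∈ Finset.range (N + 1), G.charpoly.coeff k • G ^ k = 0 := by
    have h := Matrix.aeval_self_charpoly G
    rwa [Polynomial.aeval_eq_sum_range, Matrix.charpoly_natDegree_eq_dim, Fintype.card_fin] at h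
  simp_rw [increment_succ_eq_pow hy τ, smul_add, Finset.sum_add_distrib, ← Matrix.smul_mulVec]
  rw [← Matrix.sum_mulVec, hCH, Matrix.zero_mulVec, zero_add]
  simp_rw [Finset.smul_sum, hornerQuotient, Finset.sum_mul, Matrix.sum_mulVec]
  rw [Finset.sum_comm' (t' := Finset.range (N + 1)) (s' := fun j => Finset.Ioc j N)]
  · refine Finset.sum_congr rfl fun j _ => Finset.sum_congr rfl fun k _ => ?_
    rw [smul_mul_assoc, Matrix.smul_mulVec]
  · intro k j
    simp only [Finset.mem_range, Finset.mem_Ioc]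
    omega

/-- The filtered regressor is an explicit linear combination of the inputs in the window. -/
theorem sum_charpoly_mul_dotProduct_regressor {N : ℕ} {G B : Matrix (Fin N) (Fin N) ℝ}
    {x u : ℕ → Fin N → ℝ}
    (hy : ∀ t, 1 ≤ t → increment x (t + 1) =
      G.mulVec (increment x t) + B.mulVec (u t - u (t - 1)))
    (τ : ℕ) (w : Fin N ⊕ Fin N ⊕ Fin N → ℝ) :
    ∑ k ∈ Finset.range (N + 1), G.charpoly.coeff k * (w ⬝ᵥ regressor x u (τ + 1 + k)) =
      ∑ j ∈ Finset.range (N + 2), windowCoeff G B w j ⬝ᵥ u (τ + j) := by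
  set p := w ∘ Sum.inl with hp
  set q := w ∘ Sum.inr ∘ Sum.inl with hq
  set r := w ∘ Sum.inr ∘ Sum.inr with hr
  have hw : ∀ k, w ⬝ᵥ regressor x u (τ + 1 + k) =
      p ⬝ᵥ increment x (τ + 1 + k) + (q ⬝ᵥ u (τ + 1 + k) + r ⬝ᵥ u (τ + k)) := by
    intro k
    have : w = Sum.elim p (Sum.elim q r) := by
      ext (i | i | i) <;> rfl
    rw [this, regressor, sumElim_dotProduct_sumElim, sumElim_dotProduct_sumElim,
      show τ + 1 + k - 1 = τ + k by omega]
  have hpy : ∑ k ∈ Finset.range (N + 1), G.charpoly.coeff k * (p ⬝ᵥ increment x (τ + 1 + k)) =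
      ∑ j ∈ Finset.range (N + 1),
        (Matrix.vecMul p (hornerQuotient G j * B) ⬝ᵥ u (τ + j + 1) -
          Matrix.vecMul p (hornerQuotient G j * B) ⬝ᵥ u (τ + j)) := by
    have h := congrArg (p ⬝ᵥ ·) (sum_charpoly_smul_increment hy τ)
    simp only [dotProduct_sum, dotProduct_smul, smul_eq_mul, Matrix.dotProduct_mulVec,
      dotProduct_sub] at h
    exact h
  simp_rw [hw, mul_add, Finset.sum_add_distrib]
  rw [hpy, Finset.sum_range_succ' _ (N + 1), Finset.sum_sub_distrib]
  simp only [windowCoeff, add_dotProduct, sub_dotProduct, smul_dotProduct, smul_eq_mul,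
    Finset.sum_add_distrib, Finset.sum_sub_distrib, ← hp, ← hq, ← hr]
  have e1 := Finset.sum_range_succ' (fun j => Matrix.vecMul p (hornerQuotient G j * B) ⬝ᵥ u (τ + j))
    (N + 1)
  rw [Finset.sum_range_succ, hornerQuotient_of_le G (Nat.le_succ N)] at e1
  have e2 := Finset.sum_range_succ' (fun j => G.charpoly.coeff j * (r ⬝ᵥ u (τ + j))) (N + 1)
  rw [Finset.sum_range_succ, charpoly_coeff_card_succ] at e2
  simp only [zero_mul, Matrix.vecMul_zero, zero_dotProduct, add_zero, ← add_assoc] at e1 e2 ⊢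
  simp only [add_right_comm τ 1] at *
  linarith

/-- Summing a nonnegative sequence over `M` disjoint blocks, dropping the first term of each. -/
theorem sum_blocks_le {f : ℕ → ℝ} (hf : ∀ t, 0 ≤ f t) (L : ℕ) {M n : ℕ} (h : M * (L + 1) ≤ n) :
    ∑ m ∈ Finset.range M, ∑ k ∈ Finset.range L, f (m * (L + 1) + 1 + 1 + k) ≤
      ∑ t ∈ Finset.Icc 1 n, f t := by
  have h1 : ∑ m ∈ Finset.range M, ∑ k ∈ Finset.range L, f (m * (L + 1) + 1 + 1 + k) ≤
      ∑ t ∈ Finset.range (M * (L + 1)), f (t + 1) := by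
    clear h
    induction M with
    | zero => simp
    | succ M ih =>
      rw [Finset.sum_range_succ, Nat.succ_mul, Finset.sum_range_add]
      refine add_le_add ih ?_
      rw [Finset.sum_range_succ']
      refine le_add_of_le_of_nonneg (le_of_eq ?_) (hf _)
      refine Finset.sum_congr rfl fun k _ => ?_
      congr 1; ring
  refine h1.trans ?_
  rw [← Finset.sum_image (f := f) (g := fun t => t + 1) (by intro a _ b _ hab; simpa using hab)]
  refine Finset.sum_le_sum_of_subset_of_nonneg ?_ fun t _ _ => hf t
  intro t ht
  simp only [Finset.mem_image, Finset.mem_range, Finset.mem_Icc] at ht ⊢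
  omega

/-- Excitation of the input over disjoint windows is dominated by the quadratic form of the
information matrix. -/
theorem sum_window_sq_le {N : ℕ} {G B : Matrix (Fin N) (Fin N) ℝ}
    {x u : ℕ → Fin N → ℝ}
    (hy : ∀ t, 1 ≤ t → increment x (t + 1) =
      G.mulVec (increment x t) + B.mulVec (u t - u (t - 1)))
    (w : Fin N ⊕ Fin N ⊕ Fin N → ℝ) {M n : ℕ} (h : M * (N + 2) ≤ n) :
    ∑ m ∈ Finset.range M,
        (∑ e : Fin (N + 2) × Fin N, windowMap G B w e * u (m * (N + 2) + 1 + e.1) e.2) ^ 2 ≤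
      (∑ k ∈ Finset.range (N + 1), G.charpoly.coeff k ^ 2) *
        ∑ t ∈ Finset.Icc 1 n, (w ⬝ᵥ regressor x u t) ^ 2 := by
  have h1 : ∀ m, (∑ e : Fin (N + 2) × Fin N,
      windowMap G B w e * u (m * (N + 2) + 1 + e.1) e.2) ^ 2 ≤
      (∑ k ∈ Finset.range (N + 1), G.charpoly.coeff k ^ 2) *
        ∑ k ∈ Finset.range (N + 1), (w ⬝ᵥ regressor x u (m * (N + 2) + 1 + 1 + k)) ^ 2 := by
    intro m
    refine le_trans (le_of_eq ?_) (Finset.sum_mul_sq_le_sq_mul_sq _ _ _)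
    rw [sum_charpoly_mul_dotProduct_regressor hy, Fintype.sum_prod_type, Finset.sum_range]
    rfl
  refine (Finset.sum_le_sum fun m _ => h1 m).trans ?_
  rw [← Finset.mul_sum]
  refine mul_le_mul_of_nonneg_left ?_ (Finset.sum_nonneg fun _ _ => sq_nonneg _)
  exact sum_blocks_le (fun t => sq_nonneg (w ⬝ᵥ regressor x u t)) (N + 1) h

/-! ### The information matrix and the least squares estimate -/

theorem increment_trajectory_succ {N : ℕ} (α : Fin N → ℝ) (G B : Matrix (Fin N) (Fin N) ℝ)
    (x₀ : Fin N → ℝ) (u : ℕ → Fin N → ℝ) {t : ℕ} (ht : 1 ≤ t) :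
    increment (trajectory α G B x₀ u) (t + 1) =
      G.mulVec (increment (trajectory α G B x₀ u) t) + B.mulVec (u t - u (t - 1)) := by
  obtain ⟨s, rfl⟩ := Nat.exists_eq_add_of_le' ht
  simp only [increment, Nat.add_sub_cancel]
  set X := trajectory α G B x₀ u with hX
  calc X (s + 1 + 1) - X (s + 1)
      = (α + G.mulVec (X (s + 1)) + B.mulVec (u (s + 1))) -
          (α + G.mulVec (X s) + B.mulVec (u s)) := rfl
    _ = _ := by rw [Matrix.mulVec_sub, Matrix.mulVec_sub]; abel

theorem dotProduct_informationMatrix_mulVec {N : ℕ} (x u : ℕ → Fin N → ℝ) (n : ℕ)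
    (w : Fin N ⊕ Fin N ⊕ Fin N → ℝ) :
    w ⬝ᵥ (informationMatrix x u n).mulVec w =
      ∑ t ∈ Finset.Icc 1 n, (w ⬝ᵥ regressor x u t) ^ 2 := by
  rw [informationMatrix, Matrix.sum_mulVec, dotProduct_sum]
  refine Finset.sum_congr rfl fun t _ => ?_
  rw [Matrix.vecMulVec_mulVec, sq, dotProduct_smul, MulOpposite.smul_eq_mul_unop,
    dotProduct_comm (regressor x u t)]
  rfl

theorem le_of_mem_spectrum_of_forall_dotProduct {ι : Type*} [Fintype ι] [DecidableEq ι]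
    {A : Matrix ι ι ℝ} {c μ : ℝ} (h : ∀ w, c * (w ⬝ᵥ w) ≤ w ⬝ᵥ A.mulVec w)
    (hμ : μ ∈ spectrum ℝ A) : c ≤ μ := by
  rw [← Matrix.spectrum_toLin', ← Module.End.hasEigenvalue_iff_mem_spectrum] at hμ
  obtain ⟨w, hw⟩ := hμ.exists_hasEigenvector
  have h1 : A.mulVec w = μ • w := by simpa using hw.apply_eq_smul
  have h2 := h w
  rw [h1, dotProduct_smul, smul_eq_mul] at h2
  have h3 : 0 < w ⬝ᵥ w :=
    lt_of_le_of_ne (Finset.sum_nonneg fun i _ => mul_self_nonneg _)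
      (fun h0 => hw.2 (dotProduct_self_eq_zero.1 h0.symm))
  exact le_of_mul_le_mul_right h2 h3

/-- The regression `y (t + 1) = [G, B, -B] φ t` carries no noise, so least squares recovers `G`
exactly as soon as the information matrix is invertible. -/
theorem olsInteraction_eq {N : ℕ} {G B : Matrix (Fin N) (Fin N) ℝ}
    {x u : ℕ → Fin N → ℝ}
    (hy : ∀ t, 1 ≤ t → increment x (t + 1) =
      G.mulVec (increment x t) + B.mulVec (u t - u (t - 1)))
    {n : ℕ} (h : IsUnit (informationMatrix x u n)) : olsInteraction x u n = G := by
  set Θ : Matrix (Fin N) (Fin N ⊕ Fin N ⊕ Fin N) ℝ :=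
    Matrix.fromCols G (Matrix.fromCols B (-B)) with hΘ
  have h1 : ∑ t ∈ Finset.Icc 1 n, Matrix.vecMulVec (increment x (t + 1)) (regressor x u t) =
      Θ * informationMatrix x u n := by
    rw [informationMatrix, Matrix.mul_sum]
    refine Finset.sum_congr rfl fun t ht => ?_
    rw [Matrix.mul_vecMulVec]
    congr 1
    rw [hy t (Finset.mem_Icc.1 ht).1, hΘ, regressor, Matrix.fromCols_mulVec_sumElim,
      Matrix.fromCols_mulVec_sumElim, Matrix.mulVec_sub, Matrix.neg_mulVec, sub_eq_add_neg]
  have h2 : olsEstimate x u n = Θ := by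
    rw [olsEstimate, h1, Matrix.mul_nonsing_inv_cancel_right _ _ ((Matrix.isUnit_iff_isUnit_det _).1 h)]
  rw [olsInteraction, h2]
  rfl

open Filter Topology

/-! ### Averages -/

/-- Weights tending to `1` do not change the limit of averages, provided the averages of the absolute
values stay bounded, here because they converge. -/
theorem tendsto_average_mul_of_tendsto_one {a X : ℕ → ℝ} {l l' : ℝ} (ha : Tendsto a atTop (𝓝 1))
    (hX : Tendsto (fun n : ℕ => (∑ i ∈ Finset.range n, X i) / n) atTop (𝓝 l))
    (hX' : Tendsto (fun n : ℕ => (∑ i ∈ Finset.range n, |X i|) / n) atTop (𝓝 l')) :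
    Tendsto (fun n : ℕ => (∑ i ∈ Finset.range n, a i * X i) / n) atTop (𝓝 l) := by
  have h1 : (fun i => (a i - 1) * X i) =o[atTop] fun i => |X i| + 1 := by
    have h2 : (fun i => a i - 1) =o[atTop] fun _ => (1 : ℝ) :=
      (Asymptotics.isLittleO_one_iff ℝ).2 (by simpa using ha.sub_const 1)
    have h3 : X =O[atTop] fun i => |X i| + 1 :=
      Asymptotics.IsBigO.of_bound 1 (Eventually.of_forall fun i => by
        rw [Real.norm_eq_abs, Real.norm_eq_abs, abs_of_nonneg (by positivity : 0 ≤ |X i| + 1)]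
        linarith)
    simpa using h2.mul_isBigO h3
  have hsum : ∀ n : ℕ, ∑ i ∈ Finset.range n, (|X i| + 1) = (∑ i ∈ Finset.range n, |X i|) + n := by
    intro n; simp [Finset.sum_add_distrib]
  have h4 := h1.sum_range (fun i => by positivity) (by
    refine tendsto_atTop_mono (fun n => ?_) tendsto_natCast_atTop_atTop
    rw [hsum]
    exact le_add_of_nonneg_left (Finset.sum_nonneg fun _ _ => abs_nonneg _))
  have h5 : (fun n : ℕ => ∑ i ∈ Finset.range n, (|X i| + 1)) =O[atTop] fun n => (n : ℝ) := by
    refine Asymptotics.isBigO_of_div_tendsto_nhds ?_ (l' + 1) ?_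
    · filter_upwards [eventually_gt_atTop 0] with n hn h0
      exact absurd h0 (by positivity)
    · refine (hX'.add_const 1).congr' ?_
      filter_upwards [eventually_gt_atTop 0] with n hn
      have : (n : ℝ) ≠ 0 := by positivity
      simp only [Pi.div_apply]
      rw [hsum, add_div, div_self this]
  have h6 := (h4.trans_isBigO h5).tendsto_div_nhds_zero
  have h7 := h6.add hX
  rw [zero_add] at h7
  refine h7.congr fun n => ?_
  rw [← add_div, ← Finset.sum_add_distrib]
  congr 1
  exact Finset.sum_congr rfl fun i _ => by ring

/-- If the empirical second moment matrix of the vectors `W m` tends to the identity, then its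
smallest eigenvalue is eventually at least `1 / 2`. -/
theorem eventually_half_mul_dotProduct_le {E : Type*} [Fintype E] [DecidableEq E]
    {W : ℕ → E → ℝ}
    (hW : ∀ e e', Tendsto (fun n : ℕ => (∑ m ∈ Finset.range n, W m e * W m e') / n) atTop
      (𝓝 (if e = e' then 1 else 0))) :
    ∀ᶠ n : ℕ in atTop, ∀ z : E → ℝ,
      n / 2 * (z ⬝ᵥ z) ≤ ∑ m ∈ Finset.range n, (∑ e, z e * W m e) ^ 2 := by
  set D : ℝ := ((Fintype.card E : ℕ) : ℝ) with hD
  have hD0 : 0 ≤ D := by positivity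
  set δ : ℝ := 1 / (2 * (D + 1)) with hδ
  have hδ0 : 0 < δ := by positivity
  have h1 : ∀ᶠ n : ℕ in atTop, ∀ e e',
      |(∑ m ∈ Finset.range n, W m e * W m e') / n - if e = e' then 1 else 0| < δ := by
    rw [eventually_all]; intro e
    rw [eventually_all]; intro e'
    have := (tendsto_order.1 ((hW e e').sub_const (if e = e' then 1 else 0)).abs).2 δ
    simp only [sub_self, abs_zero] at this
    exact this hδ0
  filter_upwards [h1, eventually_gt_atTop 0] with n hn hn0 z
  have hn0' : (0 : ℝ) < n := by exact_mod_cast hn0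
  set A : E → E → ℝ := fun e e' => (∑ m ∈ Finset.range n, W m e * W m e') / n with hA
  have h2 : ∑ m ∈ Finset.range n, (∑ e, z e * W m e) ^ 2 =
      n * ∑ e, ∑ e', z e * z e' * A e e' := by
    simp_rw [sq, Finset.sum_mul_sum]
    rw [Finset.sum_comm, Finset.mul_sum]
    refine Finset.sum_congr rfl fun e _ => ?_
    rw [Finset.sum_comm, Finset.mul_sum]
    refine Finset.sum_congr rfl fun e' _ => ?_
    simp only [hA]
    rw [← mul_div_assoc, mul_div_cancel₀ _ hn0'.ne', Finset.mul_sum]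
    exact Finset.sum_congr rfl fun m _ => by ring
  have h3 : z ⬝ᵥ z = ∑ e, ∑ e', z e * z e' * (if e = e' then 1 else 0) := by
    simp [dotProduct]
  have h4 : -(δ * (∑ e, |z e|) ^ 2) ≤ ∑ e, ∑ e', z e * z e' * A e e' - z ⬝ᵥ z := by
    rw [h3, ← Finset.sum_sub_distrib, sq, Finset.sum_mul_sum, Finset.mul_sum,
      ← Finset.sum_neg_distrib]
    refine Finset.sum_le_sum fun e _ => ?_
    rw [← Finset.sum_sub_distrib, Finset.mul_sum, ← Finset.sum_neg_distrib]
    refine Finset.sum_le_sum fun e' _ => ?_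
    rw [← mul_sub]
    refine le_trans (neg_le_neg ?_) (neg_abs_le _)
    rw [abs_mul, abs_mul, mul_comm δ]
    exact mul_le_mul_of_nonneg_left (hn e e').le (by positivity)
  have h5 : (∑ e, |z e|) ^ 2 ≤ D * (z ⬝ᵥ z) := by
    refine sq_sum_le_card_mul_sum_sq.trans (le_of_eq ?_)
    simp [hD, dotProduct, sq]
  have hzz : 0 ≤ z ⬝ᵥ z := Finset.sum_nonneg fun i _ => mul_self_nonneg _
  have h6 : δ * (∑ e, |z e|) ^ 2 ≤ 1 / 2 * (z ⬝ᵥ z) := by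
    calc δ * (∑ e, |z e|) ^ 2 ≤ δ * ((D + 1) * (z ⬝ᵥ z)) := by gcongr; linarith
      _ = _ := by rw [hδ]; field_simp
  rw [h2, div_mul_eq_mul_div, mul_div_assoc]
  refine mul_le_mul_of_nonneg_left ?_ hn0'.le
  linarith

/-! ### Strong law for products of white noise -/

section Noise

variable {Ω : Type*} [MeasurableSpace Ω] {P : Measure Ω} [IsProbabilityMeasure P]

/-- Strong law for the products `ξ (f m) * ξ (g m)` of entries of a Gaussian white noise, where the
index pairs `(f m, g m)` are disjoint for different `m`. -/
theorem ae_tendsto_average_mul_whiteNoise {ι : Type*} {ξ : ι → Ω → ℝ}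
    (hm : ∀ i, Measurable (ξ i)) (hlaw : ∀ i, HasLaw (ξ i) (gaussianReal 0 1) P)
    (hind : iIndepFun ξ P) {f g : ℕ → ι}
    (hff : ∀ m m', m ≠ m' → f m ≠ f m') (hfg : ∀ m m', m ≠ m' → f m ≠ g m')
    (hgg : ∀ m m', m ≠ m' → g m ≠ g m')
    (c : Prop) [Decidable c] (hc : c → ∀ m, f m = g m) (hc' : ¬ c → ∀ m, f m ≠ g m) :
    ∀ᵐ ω ∂P,
      Tendsto (fun n : ℕ => (∑ m ∈ Finset.range n, ξ (f m) ω * ξ (g m) ω) / n) atTop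
        (𝓝 (if c then 1 else 0)) ∧
      ∃ l, Tendsto (fun n : ℕ => (∑ m ∈ Finset.range n, |ξ (f m) ω * ξ (g m) ω|) / n) atTop
        (𝓝 l) := by
  have hL2 : ∀ i, MemLp (ξ i) 2 P := fun i => by
    have h := memLp_id_gaussianReal (μ := 0) (v := 1) 2
    rw [← (hlaw i).map_eq, memLp_map_measure_iff aestronglyMeasurable_id (hm i).aemeasurable] at h
    exact h
  have hmean : ∀ i, ∫ ω, ξ i ω ∂P = 0 := fun i => by
    rw [(hlaw i).integral_eq, integral_id_gaussianReal]
  have hsq : ∀ i, ∫ ω, ξ i ω * ξ i ω ∂P = 1 := fun i => by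
    have h1 := variance_eq_sub (hL2 i)
    have h2 : Var[ξ i; P] = 1 := by
      rw [(hlaw i).variance_eq, variance_id_gaussianReal]; rfl
    rw [h2, hmean i] at h1
    simpa [sq] using h1.symm
  have hident : ∀ i j, IdentDistrib (ξ i) (ξ j) P P := fun i j => (hlaw i).identDistrib (hlaw j)
  have hpair : ∀ m, IdentDistrib (fun ω => (ξ (f m) ω, ξ (g m) ω))
      (fun ω => (ξ (f 0) ω, ξ (g 0) ω)) P P := by
    intro m
    by_cases h : c
    · simp_rw [← hc h]
      exact (hident (f m) (f 0)).comp (u := fun x => (x, x)) (by fun_prop)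
    · exact (hident _ _).prodMk (hident _ _) (hind.indepFun (hc' h m)) (hind.indepFun (hc' h 0))
  have hpi : ∀ m m', m ≠ m' → IndepFun (fun ω => (ξ (f m) ω, ξ (g m) ω))
      (fun ω => (ξ (f m') ω, ξ (g m') ω)) P := fun m m' h =>
    hind.indepFun_prodMk_prodMk hm _ _ _ _ (hff m m' h) (hfg m m' h) (hfg m' m h.symm).symm
      (hgg m m' h)
  have hint : Integrable (fun ω => ξ (f 0) ω * ξ (g 0) ω) P := (hL2 _).integrable_mul (hL2 _)
  have hE : ∫ ω, ξ (f 0) ω * ξ (g 0) ω ∂P = if c then 1 else 0 := by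
    split_ifs with h
    · rw [← hc h]; exact hsq _
    · have := (hind.indepFun (hc' h 0)).integral_mul_eq_mul_integral
        (hm _).aestronglyMeasurable (hm _).aestronglyMeasurable
      rw [hmean, zero_mul] at this
      exact this
  have s1 := strong_law_ae_real (fun m ω => ξ (f m) ω * ξ (g m) ω) hint
    (fun m m' h => (hpi m m' h).comp (φ := fun x : ℝ × ℝ => x.1 * x.2)
      (ψ := fun x : ℝ × ℝ => x.1 * x.2) (by fun_prop) (by fun_prop))
    (fun m => (hpair m).comp (u := fun x : ℝ × ℝ => x.1 * x.2) (by fun_prop))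
  have s2 := strong_law_ae_real (fun m ω => |ξ (f m) ω * ξ (g m) ω|) hint.abs
    (fun m m' h => (hpi m m' h).comp (φ := fun x : ℝ × ℝ => |x.1 * x.2|)
      (ψ := fun x : ℝ × ℝ => |x.1 * x.2|) (by fun_prop) (by fun_prop))
    (fun m => (hpair m).comp (u := fun x : ℝ × ℝ => |x.1 * x.2|) (by fun_prop))
  filter_upwards [s1, s2] with ω h1 h2
  rw [hE] at h1
  exact ⟨h1, _, h2⟩

/-- The entries of independent standard Gaussian vectors form a Gaussian white noise. -/
theorem iIndepFun_entries_of_hasLaw_pi {N : ℕ} {ξ : ℕ → Ω → Fin N → ℝ}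
    (hm : ∀ s, Measurable (ξ s))
    (hlaw : ∀ s, HasLaw (ξ s) (Measure.pi fun _ : Fin N => gaussianReal 0 1) P)
    (hind : iIndepFun ξ P) :
    (∀ e : ℕ × Fin N, HasLaw (fun ω => ξ e.1 ω e.2) (gaussianReal 0 1) P) ∧
      iIndepFun (fun (e : ℕ × Fin N) ω => ξ e.1 ω e.2) P := by
  have h1 : ∀ (s : ℕ) (i : Fin N), HasLaw (fun ω => ξ s ω i) (gaussianReal 0 1) P := by
    intro s i
    refine ⟨((measurable_pi_apply i).comp (hm s)).aemeasurable, ?_⟩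
    have h2 : P.map (fun ω => ξ s ω i) = (P.map (ξ s)).map (Function.eval i) :=
      (Measure.map_map (measurable_pi_apply i) (hm s)).symm
    rw [h2, (hlaw s).map_eq]
    exact (measurePreserving_eval _ i).map_eq
  refine ⟨fun e => h1 e.1 e.2, iIndepFun_uncurry' (X := fun s i ω => ξ s ω i)
    (fun s i => (measurable_pi_apply i).comp (hm s)) hind fun s => ?_⟩
  have hmi : ∀ i, AEMeasurable (fun ω => ξ s ω i) P :=
    fun i => ((measurable_pi_apply i).comp (hm s)).aemeasurable
  rw [iIndepFun_iff_map_fun_eq_pi_map hmi]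
  simp_rw [(h1 s _).map_eq]
  exact (hlaw s).map_eq

/-- For independent standard Gaussian vectors cut into consecutive windows of length `K`, the
empirical second moments of the windows converge almost surely to the identity. -/
theorem ae_tendsto_average_window {N : ℕ} {ξ : ℕ → Ω → Fin N → ℝ}
    (hlaw : ∀ s, HasLaw (ξ s) (Measure.pi fun _ : Fin N => gaussianReal 0 1) P)
    (hind : iIndepFun ξ P) (K : ℕ) :
    ∀ᵐ ω ∂P, ∀ e e' : Fin K × Fin N,
      Tendsto (fun n : ℕ => (∑ m ∈ Finset.range n,
        ξ (m * K + e.1) ω e.2 * ξ (m * K + e'.1) ω e'.2) / n) atTop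
        (𝓝 (if e = e' then 1 else 0)) ∧
      ∃ l, Tendsto (fun n : ℕ => (∑ m ∈ Finset.range n,
        |ξ (m * K + e.1) ω e.2 * ξ (m * K + e'.1) ω e'.2|) / n) atTop (𝓝 l) := by
  -- The vectors are only almost everywhere measurable, so measurable versions take their place.
  set ξ' : ℕ → Ω → Fin N → ℝ := fun s => (hlaw s).aemeasurable.mk (ξ s) with hξ'
  have hae : ∀ s, ξ s =ᵐ[P] ξ' s := fun s => (hlaw s).aemeasurable.ae_eq_mk
  have hm : ∀ s, Measurable (ξ' s) := fun s => (hlaw s).aemeasurable.measurable_mk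
  have hlaw' : ∀ s, HasLaw (ξ' s) (Measure.pi fun _ : Fin N => gaussianReal 0 1) P :=
    fun s => ⟨(hm s).aemeasurable, by rw [← Measure.map_congr (hae s), (hlaw s).map_eq]⟩
  obtain ⟨h1, h2⟩ := iIndepFun_entries_of_hasLaw_pi hm hlaw' (hind.congr hae)
  have hdiv : ∀ (m : ℕ) (j : Fin K), (m * K + j) / K = m := fun m j => by
    have hK : 0 < K := j.pos
    rw [mul_comm, Nat.mul_add_div hK, Nat.div_eq_of_lt j.2, add_zero]
  have hne : ∀ (e e' : Fin K × Fin N) (m m' : ℕ), m ≠ m' →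
      ((m * K + e.1 : ℕ), e.2) ≠ ((m' * K + e'.1 : ℕ), e'.2) := by
    intro e e' m m' hmm h
    have := congrArg (· / K) (congrArg Prod.fst h)
    simp only [hdiv] at this
    exact hmm this
  have key : ∀ᵐ ω ∂P, ∀ e e' : Fin K × Fin N,
      Tendsto (fun n : ℕ => (∑ m ∈ Finset.range n,
        ξ' (m * K + e.1) ω e.2 * ξ' (m * K + e'.1) ω e'.2) / n) atTop
        (𝓝 (if e = e' then 1 else 0)) ∧
      ∃ l, Tendsto (fun n : ℕ => (∑ m ∈ Finset.range n,
        |ξ' (m * K + e.1) ω e.2 * ξ' (m * K + e'.1) ω e'.2|) / n) atTop (𝓝 l) := by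
    rw [ae_all_iff]; intro e
    rw [ae_all_iff]; intro e'
    refine ae_tendsto_average_mul_whiteNoise (ξ := fun (e : ℕ × Fin N) ω => ξ' e.1 ω e.2)
      (fun e => (measurable_pi_apply e.2).comp (hm e.1)) h1 h2
      (f := fun m => (m * K + e.1, e.2)) (g := fun m => (m * K + e'.1, e'.2))
      (hne e e) (hne e e') (hne e' e') (e = e') (fun h m => by rw [h]) ?_
    intro h m hm'
    apply h
    simp only [Prod.mk.injEq, add_right_inj] at hm'
    exact Prod.ext (Fin.ext hm'.1) hm'.2
  filter_upwards [key, ae_all_iff.2 hae] with ω hω hω'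
  simpa only [hω'] using hω

end Noise

/-! ### Rescaled windows of the probing signal -/

/-- Within a window the factors `t ^ (-ε / 2)` are asymptotically equal. -/
theorem tendsto_rescaling_ratio (ε : ℝ) {K : ℕ} (j : Fin K) :
    Tendsto (fun m : ℕ => ((m * K + K : ℕ) : ℝ) ^ (ε / 2) *
      (((m * K + j + 1 : ℕ) : ℝ) ^ (ε / 2))⁻¹) atTop (𝓝 1) := by
  have hK : 0 < K := j.pos
  have h1 : Tendsto (fun m : ℕ => (m * K + j + 1 : ℕ)) atTop atTop :=
    tendsto_atTop_mono (fun m => by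
      have := Nat.le_mul_of_pos_right m hK
      simp only [id]
      omega) tendsto_id
  have h2 : Tendsto (fun m : ℕ => ((m * K + K : ℕ) : ℝ) / ((m * K + j + 1 : ℕ) : ℝ))
      atTop (𝓝 1) := by
    have h3 : Tendsto (fun m : ℕ => ((K : ℝ) - j - 1) / ((m * K + j + 1 : ℕ) : ℝ)) atTop (𝓝 0) :=
      (tendsto_natCast_atTop_atTop.comp h1).const_div_atTop _
    have h4 := h3.const_add 1
    rw [add_zero] at h4
    refine h4.congr fun m => ?_
    have : ((m * K + j + 1 : ℕ) : ℝ) ≠ 0 := by positivity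
    rw [eq_div_iff this, add_mul, div_mul_cancel₀ _ this]
    push_cast
    ring
  have h5 := h2.rpow_const (p := ε / 2) (Or.inl one_ne_zero)
  rw [Real.one_rpow] at h5
  refine h5.congr fun m => ?_
  rw [Real.div_rpow (by positivity) (by positivity), div_eq_mul_inv]

/-- Along a realisation whose noise windows have second moments converging to the identity, the
windows of the probing signal, rescaled by `(m K + K) ^ (ε / 2)`, are uniformly exciting. -/
theorem eventually_window_excitation {N : ℕ} (ε : ℝ) {u v : ℕ → Fin N → ℝ}
    (hu : ∀ s, u (s + 1) = (((s + 1 : ℕ) : ℝ) ^ (ε / 2))⁻¹ • v (s + 1)) (K : ℕ)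
    (h : ∀ e e' : Fin K × Fin N,
      Tendsto (fun n : ℕ => (∑ m ∈ Finset.range n,
        v (m * K + e.1 + 1) e.2 * v (m * K + e'.1 + 1) e'.2) / n) atTop
        (𝓝 (if e = e' then 1 else 0)) ∧
      ∃ l, Tendsto (fun n : ℕ => (∑ m ∈ Finset.range n,
        |v (m * K + e.1 + 1) e.2 * v (m * K + e'.1 + 1) e'.2|) / n) atTop (𝓝 l)) :
    ∀ᶠ n : ℕ in atTop, ∀ z : Fin K × Fin N → ℝ,
      n / 2 * (z ⬝ᵥ z) ≤ ∑ m ∈ Finset.range n, (∑ e, z e *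
        (((m * K + K : ℕ) : ℝ) ^ (ε / 2) * u (m * K + 1 + e.1) e.2)) ^ 2 := by
  set W : ℕ → Fin K × Fin N → ℝ := fun m e =>
    ((m * K + K : ℕ) : ℝ) ^ (ε / 2) * u (m * K + 1 + e.1) e.2 with hW
  suffices hlim : ∀ e e', Tendsto (fun n : ℕ => (∑ m ∈ Finset.range n, W m e * W m e') / n) atTop
      (𝓝 (if e = e' then 1 else 0)) from eventually_half_mul_dotProduct_le hlim
  intro e e'
  simp only [hW]
  obtain ⟨h1, l, h2⟩ := h e e'
  have ha := (tendsto_rescaling_ratio ε e.1).mul (tendsto_rescaling_ratio ε e'.1)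
  rw [mul_one] at ha
  have hp : ∀ (m : ℕ) (d : Fin K × Fin N), u (m * K + 1 + d.1) d.2 =
      (((m * K + d.1 + 1 : ℕ) : ℝ) ^ (ε / 2))⁻¹ * v (m * K + d.1 + 1) d.2 := fun m d => by
    rw [add_right_comm (m * K) 1, hu, Pi.smul_apply, smul_eq_mul]
  have h3 := tendsto_average_mul_of_tendsto_one ha h1 h2
  have hsum : ∀ n : ℕ,
      ∑ m ∈ Finset.range n, (((m * K + K : ℕ) : ℝ) ^ (ε / 2) * u (m * K + 1 + e.1) e.2) *
        (((m * K + K : ℕ) : ℝ) ^ (ε / 2) * u (m * K + 1 + e'.1) e'.2) =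
      ∑ m ∈ Finset.range n,
        (((m * K + K : ℕ) : ℝ) ^ (ε / 2) * (((m * K + e.1 + 1 : ℕ) : ℝ) ^ (ε / 2))⁻¹ *
          (((m * K + K : ℕ) : ℝ) ^ (ε / 2) * (((m * K + e'.1 + 1 : ℕ) : ℝ) ^ (ε / 2))⁻¹)) *
        (v (m * K + e.1 + 1) e.2 * v (m * K + e'.1 + 1) e'.2) := by
    intro n
    refine Finset.sum_congr rfl fun m _ => ?_
    rw [hp, hp]
    ring
  simp only [hsum]
  exact h3

/-! ### Growth of the information matrix -/

/-- If the rescaled windows of the input are uniformly exciting, the quadratic form of the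
information matrix grows at least like `n ^ (1 - ε)`. -/
theorem exists_mul_rpow_le_informationMatrix {N : ℕ} {G B : Matrix (Fin N) (Fin N) ℝ}
    (hctrl : IsControllable G B) (h1 : G.charpoly.eval 1 ≠ 0) {ε : ℝ} (hε : 0 ≤ ε)
    {x u : ℕ → Fin N → ℝ}
    (hy : ∀ t, 1 ≤ t → increment x (t + 1) =
      G.mulVec (increment x t) + B.mulVec (u t - u (t - 1)))
    (hu : ∀ᶠ M : ℕ in atTop, ∀ z : Fin (N + 2) × Fin N → ℝ,
      M / 2 * (z ⬝ᵥ z) ≤ ∑ m ∈ Finset.range M, (∑ e, z e *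
        (((m * (N + 2) + (N + 2) : ℕ) : ℝ) ^ (ε / 2) * u (m * (N + 2) + 1 + e.1) e.2)) ^ 2) :
    ∃ c : ℝ, 0 < c ∧ ∀ᶠ n : ℕ in atTop, ∀ w,
      c * (n : ℝ) ^ (1 - ε) * (w ⬝ᵥ w) ≤ w ⬝ᵥ (informationMatrix x u n).mulVec w := by
  obtain ⟨c₀, hc₀, hc⟩ := exists_pos_mul_dotProduct_le _ (windowMap_injective hctrl h1)
  set C : ℝ := ∑ k ∈ Finset.range (N + 1), G.charpoly.coeff k ^ 2 with hC
  have hC0 : 0 < C := by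
    refine Finset.sum_pos' (fun _ _ => sq_nonneg _) ⟨N, Finset.self_mem_range_succ N, ?_⟩
    rw [charpoly_coeff_card]; norm_num
  have hK0 : (0 : ℝ) < N + 2 := by positivity
  refine ⟨c₀ / (4 * (N + 2) * C), by positivity, ?_⟩
  have hdiv : Tendsto (fun n : ℕ => n / (N + 2)) atTop atTop :=
    Nat.tendsto_div_const_atTop (by omega)
  filter_upwards [hdiv.eventually hu, eventually_ge_atTop (2 * (N + 2)),
    eventually_gt_atTop 0] with n hn hn2 hn0 w
  have hn0' : (0 : ℝ) < n := by exact_mod_cast hn0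
  set M := n / (N + 2) with hM
  have hMn : M * (N + 2) ≤ n := Nat.div_mul_le_self n (N + 2)
  have hMlow : (n : ℝ) / (2 * (N + 2)) ≤ M := by
    have h2 : n < (M + 1) * (N + 2) := by
      rw [mul_comm]; exact Nat.lt_mul_div_succ n (by omega)
    have h3 : n ≤ M * (2 * (N + 2)) := by nlinarith
    rw [div_le_iff₀ (by positivity)]
    exact_mod_cast h3
  set z := windowMap G B w with hz
  have hzz : 0 ≤ z ⬝ᵥ z := Finset.sum_nonneg fun i _ => mul_self_nonneg _
  have hww : 0 ≤ w ⬝ᵥ w := Finset.sum_nonneg fun i _ => mul_self_nonneg _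
  -- Undoing the rescaling costs at most the factor `n ^ ε`.
  have h4 : ∑ m ∈ Finset.range M, (∑ e, z e *
        (((m * (N + 2) + (N + 2) : ℕ) : ℝ) ^ (ε / 2) * u (m * (N + 2) + 1 + e.1) e.2)) ^ 2 ≤
      (n : ℝ) ^ ε * ∑ m ∈ Finset.range M,
        (∑ e, z e * u (m * (N + 2) + 1 + e.1) e.2) ^ 2 := by
    rw [Finset.mul_sum]
    refine Finset.sum_le_sum fun m hm => ?_
    set s : ℝ := ((m * (N + 2) + (N + 2) : ℕ) : ℝ) with hs
    have e1 : ∑ e, z e * (s ^ (ε / 2) * u (m * (N + 2) + 1 + e.1) e.2) =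
        s ^ (ε / 2) * ∑ e, z e * u (m * (N + 2) + 1 + e.1) e.2 := by
      rw [Finset.mul_sum]
      exact Finset.sum_congr rfl fun e _ => by ring
    have hs0 : 0 ≤ s := by positivity
    have e2 : (s ^ (ε / 2)) ^ 2 = s ^ ε := by
      rw [← Real.rpow_natCast, ← Real.rpow_mul hs0]; norm_num
    have hsn : s ≤ n := by
      have h5 : (m + 1) * (N + 2) ≤ M * (N + 2) :=
        Nat.mul_le_mul_right _ (Finset.mem_range.1 hm)
      rw [hs]
      exact_mod_cast (by nlinarith : m * (N + 2) + (N + 2) ≤ n)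
    rw [e1, mul_pow, e2]
    exact mul_le_mul_of_nonneg_right (Real.rpow_le_rpow hs0 hsn hε) (sq_nonneg _)
  have h5 := sum_window_sq_le hy w hMn
  rw [← dotProduct_informationMatrix_mulVec, ← hC, ← hz] at h5
  have hne : 0 < (n : ℝ) ^ ε := Real.rpow_pos_of_pos hn0' ε
  have h6 : M / 2 * (z ⬝ᵥ z) ≤
      (n : ℝ) ^ ε * (C * (w ⬝ᵥ (informationMatrix x u n).mulVec w)) :=
    ((hn z).trans h4).trans (mul_le_mul_of_nonneg_left h5 hne.le)
  have h7 : (n : ℝ) / (2 * (N + 2)) / 2 * (c₀ * (w ⬝ᵥ w)) ≤ M / 2 * (z ⬝ᵥ z) := by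
    gcongr
    exact hc w
  have h8 := h7.trans h6
  rw [Real.rpow_sub hn0', Real.rpow_one]
  refine le_of_mul_le_mul_left ?_ (mul_pos hne hC0)
  calc (n : ℝ) ^ ε * C * (c₀ / (4 * (N + 2) * C) * (n / (n : ℝ) ^ ε) * (w ⬝ᵥ w))
      = (n : ℝ) / (2 * (N + 2)) / 2 * (c₀ * (w ⬝ᵥ w)) := by field_simp; norm_num
    _ ≤ _ := h8
    _ = _ := by ring

theorem theorem2 {N : ℕ} {Ω : Type*} [MeasurableSpace Ω] (P : Measure Ω) [IsProbabilityMeasure P]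
    (α : Fin N → ℝ) (G : Matrix (Fin N) (Fin N) ℝ) (b : Fin N → ℝ)
    (hdiag : ∀ i, G i i = 0)
    (hb : ∀ i, b i = 0 ∨ b i = 1)
    (hstable : spectralRadius ℂ (G.map (algebraMap ℝ ℂ)) < 1)
    (hctrl : IsControllable G (Matrix.diagonal b))
    (ε : ℝ) (hε : ε ∈ Set.Icc (0 : ℝ) (1 / ((N : ℝ) + 1)))
    (x₀ u₀ : Fin N → ℝ)
    (v : ℕ → Ω → Fin N → ℝ)
    (hlaw : ∀ t, 1 ≤ t → HasLaw (v t) (Measure.pi fun _ : Fin N => gaussianReal 0 1) P)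
    (hindep : iIndepFun (fun t : ℕ => v (t + 1)) P) :
    let u : Ω → ℕ → Fin N → ℝ := fun ω => probe ε u₀ fun t => v t ω
    let x : Ω → ℕ → Fin N → ℝ := fun ω => trajectory α G (Matrix.diagonal b) x₀ (u ω)
    ∃ Ω₀ : Set Ω, MeasurableSet Ω₀ ∧ P Ω₀ = 1 ∧ ∀ ω ∈ Ω₀,
      (∃ n₀ : ℕ, ∀ n, n₀ ≤ n →
        IsUnit (informationMatrix (x ω) (u ω) n) ∧ olsInteraction (x ω) (u ω) n = G) ∧
      (∀ a ∈ Set.Ioo (1 / 2 : ℝ) (1 - ε), ∃ c : ℝ, 0 < c ∧ ∀ᶠ n : ℕ in Filter.atTop,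
        ∀ μ ∈ spectrum ℝ (informationMatrix (x ω) (u ω) n), c * (n : ℝ) ^ a ≤ μ) := by
  intro u x
  have h1 := charpoly_eval_one_ne_zero hstable
  have hae := ae_tendsto_average_window (fun s => hlaw (s + 1) (by omega)) hindep (N + 2)
  obtain ⟨T, hT, hTm, hT0⟩ := exists_measurable_superset_of_null (mem_ae_iff.1 hae)
  refine ⟨Tᶜ, hTm.compl, (prob_compl_eq_one_iff hTm).2 hT0, fun ω hω => ?_⟩
  have hω' := not_not.1 fun h => hω (hT h)
  have hy : ∀ t, 1 ≤ t → increment (x ω) (t + 1) =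
      G.mulVec (increment (x ω) t) + (Matrix.diagonal b).mulVec (u ω t - u ω (t - 1)) :=
    fun t ht => increment_trajectory_succ α G (Matrix.diagonal b) x₀ (u ω) ht
  obtain ⟨c, hc, hn⟩ := exists_mul_rpow_le_informationMatrix hctrl h1 hε.1 hy
    (eventually_window_excitation ε (v := fun t => v t ω) (fun _ => rfl) (N + 2) hω')
  have hspec : ∀ᶠ n : ℕ in atTop, ∀ μ ∈ spectrum ℝ (informationMatrix (x ω) (u ω) n),
      c * (n : ℝ) ^ (1 - ε) ≤ μ := by
    filter_upwards [hn] with n hn μ hμ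
    exact le_of_mem_spectrum_of_forall_dotProduct hn hμ
  constructor
  · obtain ⟨n₀, h⟩ := eventually_atTop.1 (hspec.and (eventually_gt_atTop 0))
    refine ⟨n₀, fun n hle => ?_⟩
    obtain ⟨hμ, hpos⟩ := h n hle
    have hunit : IsUnit (informationMatrix (x ω) (u ω) n) := by
      rw [← spectrum.zero_notMem_iff ℝ]
      intro h0
      have hp : 0 < c * (n : ℝ) ^ (1 - ε) :=
        mul_pos hc (Real.rpow_pos_of_pos (by exact_mod_cast hpos) _)
      exact absurd (hμ 0 h0) (not_le.2 hp)
    exact ⟨hunit, olsInteraction_eq hy hunit⟩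
  · intro a ha
    refine ⟨c, hc, ?_⟩
    filter_upwards [hspec, eventually_ge_atTop 1] with n h hn1 μ hμ
    refine le_trans ?_ (h μ hμ)
    exact mul_le_mul_of_nonneg_left
      (Real.rpow_le_rpow_of_exponent_le (by exact_mod_cast hn1) ha.2.le) hc.le
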